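/- For $n\ge 1$ let $\pi_n$ be a uniformly random permutation of $[n]=\{1,\dots,n\}$, and let $G_{\pi_n}$ be its permutation graph: the graph on the vertex set $[n]$ in which $i$ and $j$ are adjacent if and only if $(i-j)(\pi_n(i)-\pi_n(j))<0$. Let $d_n(i)$ denote the degree of the vertex $i$ in $G_{\pi_n}$. Then, as $n\to\infty$, $$\sqrt{n}\left(\frac{d_n(\lceil n/2\rceil)}{n}-\frac12\right)\xrightarrow{\ \mathcal D\ } N(0,U(1-U)),\qquad U\sim\mathrm{Uniform}[0,1],$$ where $N(0,U(1-U))$ denotes the normal mixture, i.e. the law of a real random variable whose conditional distribution given $U=u$ is normal with mean $0$ and variance $u(1-u)$. -/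

import Mathlib

open MeasureTheory ProbabilityTheory Filter Topology

/-- The permutation graph of a permutation `σ` of `n` labels: `i` and `j` are adjacent iff they form
an inversion of `σ`. The label `i ∈ {1, …, n}` is represented by `i - 1 : Fin n`, a shift which
does not affect the differences below. -/
def permGraph {n : ℕ} (σ : Equiv.Perm (Fin n)) : SimpleGraph (Fin n) where
  Adj i j := (((i : ℕ) : ℤ) - ((j : ℕ) : ℤ)) * (((σ i : ℕ) : ℤ) - ((σ j : ℕ) : ℤ)) < 0
  symm := ⟨fun i j h => by
    have e : (((j : ℕ) : ℤ) - ((i : ℕ) : ℤ)) * (((σ j : ℕ) : ℤ) - ((σ i : ℕ) : ℤ))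
      = (((i : ℕ) : ℤ) - ((j : ℕ) : ℤ)) * (((σ i : ℕ) : ℤ) - ((σ j : ℕ) : ℤ)) := by ring
    rw [e]; exact h⟩
  loopless := ⟨fun i h => by simp at h⟩

instance permGraph.decidableAdj {n : ℕ} (σ : Equiv.Perm (Fin n)) :
    DecidableRel (permGraph σ).Adj :=
  fun i j => inferInstanceAs (Decidable
    ((((i : ℕ) : ℤ) - ((j : ℕ) : ℤ)) * (((σ i : ℕ) : ℤ) - ((σ j : ℕ) : ℤ)) < 0))

/-- The vertex labelled `⌈n / 2⌉` (as an element of `Fin n` it is shifted by one). -/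
noncomputable def midVertex (n : ℕ+) : Fin n :=
  ⟨⌈((n : ℕ) : ℝ) / 2⌉₊ - 1, by
    have h1 : (1 : ℝ) ≤ ((n : ℕ) : ℝ) := by exact_mod_cast n.pos
    have h2 : ⌈((n : ℕ) : ℝ) / 2⌉₊ ≤ (n : ℕ) := Nat.ceil_le.2 (by linarith)
    have h3 := n.pos
    omega⟩

/-- Permutations of a finite set of labels carry the discrete σ-algebra. -/
instance permMeasurableSpace (n : ℕ) : MeasurableSpace (Equiv.Perm (Fin n)) := ⊤

/-- The normal mixture `N(0, U(1 - U))` with `U` uniform on `[0, 1]`: the law of a random variable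
whose conditional law given `U = u` is normal with mean `0` and variance `u(1 - u)`. -/
noncomputable def normalMixture : Measure ℝ :=
  (volume.restrict (Set.Icc (0 : ℝ) 1)).bind (fun u => gaussianReal 0 (u * (1 - u)).toNNReal)

theorem measurable_normalMixture_kernel :
    Measurable (fun u : ℝ => gaussianReal 0 (u * (1 - u)).toNNReal) :=
  measurable_gaussianReal.comp
    (measurable_const.prodMk (by fun_prop : Measurable fun u : ℝ => (u * (1 - u)).toNNReal))

instance normalMixture.isProbabilityMeasure : IsProbabilityMeasure normalMixture where
  measure_univ := by
    rw [normalMixture, Measure.bind_apply MeasurableSet.univ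
      measurable_normalMixture_kernel.aemeasurable]
    simp

/-! Write `m` for the middle vertex and B for the set of positions with value below `σ m`. A
position before `m` is a neighbour iff it is not in B, one after `m` iff it is, so the degree is `m`
plus a sum of signs over B (`degree_permGraph`). The size of B is uniform on 0, …, n - 1 and, given
its size, B is uniform among subsets avoiding `m`. By the Beta integral this is the law obtained by
drawing U uniform and keeping each other position independently with probability U
(`sum_perm_prod_lowerPositions`). Hence, up to a phase tending to 1, the characteristic function is
an integral over u of products of Bernoulli characteristic functions at t/√n and -t/√n. Pairing
opposite signs gives real factors 1 - u(1-u)t²/n + o(1/n), about n/2 of them, with limit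
exp(-u(1-u)t²/2). Dominated convergence and Lévy's continuity theorem conclude. -/

/-! ### The law of the set of lower positions. -/

/-- The positions whose value under `σ` is below the value at `m`. -/
def lowerPositions {n : ℕ} (m : Fin n) (σ : Equiv.Perm (Fin n)) : Finset (Fin n) :=
  Finset.univ.filter fun j => σ j < σ m

theorem mem_lowerPositions {n : ℕ} {m j : Fin n} {σ : Equiv.Perm (Fin n)} :
    j ∈ lowerPositions m σ ↔ σ j < σ m := by
  simp [lowerPositions]

theorem card_lowerPositions {n : ℕ} (m : Fin n) (σ : Equiv.Perm (Fin n)) :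
    (lowerPositions m σ).card = (σ m : ℕ) := by
  have h : (lowerPositions m σ).map σ.toEmbedding = Finset.Iio (σ m) := by
    ext k
    simp only [Finset.mem_map_equiv, mem_lowerPositions, Equiv.apply_symm_apply, Finset.mem_Iio]
  rw [← Finset.card_map σ.toEmbedding, h, Fin.card_Iio]

theorem exists_perm_fixing_mem_iff {α : Type*} [Fintype α] [DecidableEq α] (m : α)
    {B C : Finset α} (hB : m ∉ B) (hC : m ∉ C) (h : B.card = C.card) :
    ∃ τ : Equiv.Perm α, τ m = m ∧ ∀ j, τ j ∈ C ↔ j ∈ B := by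
  let e : {x // x ∈ B} ≃ {x // x ∈ C} := Finset.equivOfCardEq h
  let g : Equiv.Perm α := e.extendSubtype
  have hg : ∀ j, g j ∈ C ↔ j ∈ B := fun j =>
    ⟨fun hj => by_contra fun hn => e.extendSubtype_not_mem j hn hj,
      fun hj => e.extendSubtype_mem j hj⟩
  have hm : g m ∉ C := fun hn => hB ((hg m).1 hn)
  -- The extension `g` may move `m`; the swap repairs this without affecting `C`, as `g m` and `m`
  -- both lie outside it.
  refine ⟨g.trans (Equiv.swap (g m) m), by simp, fun j => ?_⟩
  rw [← hg j, Equiv.trans_apply]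
  by_cases h1 : g j = g m
  · rw [h1, Equiv.swap_apply_left]; tauto
  by_cases h2 : g j = m
  · rw [h2, Equiv.swap_apply_right]; tauto
  rw [Equiv.swap_apply_of_ne_of_ne h1 h2]

theorem card_lowerPositions_eq_congr {n : ℕ} (m : Fin n) {B C : Finset (Fin n)}
    (hB : m ∉ B) (hC : m ∉ C) (h : B.card = C.card) :
    (Finset.univ.filter fun σ => lowerPositions m σ = B).card =
      (Finset.univ.filter fun σ => lowerPositions m σ = C).card := by
  obtain ⟨τ, hτ, hBC⟩ := exists_perm_fixing_mem_iff m hB hC h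
  refine Finset.card_equiv (Equiv.mulRight τ⁻¹) fun σ => ?_
  simp only [Finset.mem_filter, Finset.mem_univ, true_and, Equiv.coe_mulRight]
  have hm : τ⁻¹ m = m := by rw [Equiv.Perm.inv_eq_iff_eq, hτ]
  have key : ∀ j, j ∈ lowerPositions m (σ * τ⁻¹) ↔ τ⁻¹ j ∈ lowerPositions m σ := fun j => by
    rw [mem_lowerPositions, mem_lowerPositions, Equiv.Perm.mul_apply, Equiv.Perm.mul_apply, hm]
  constructor
  · intro hσ
    ext j
    rw [key, hσ, ← hBC]
    simp
  · intro hσ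
    ext j
    rw [← hBC, ← hσ, key]
    simp

theorem card_perm_apply_eq {n : ℕ} (m k : Fin n) :
    n * (Finset.univ.filter fun σ : Equiv.Perm (Fin n) => σ m = k).card = n.factorial := by
  have h1 : ∀ l : Fin n, (Finset.univ.filter fun σ : Equiv.Perm (Fin n) => σ m = l).card =
      (Finset.univ.filter fun σ : Equiv.Perm (Fin n) => σ m = k).card := fun l => by
    refine Finset.card_equiv (Equiv.mulLeft (Equiv.swap l k)) fun σ => ?_
    simp [Equiv.swap_apply_eq_iff]
  have h2 := Finset.card_eq_sum_card_fiberwise (s := (Finset.univ : Finset (Equiv.Perm (Fin n))))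
    (t := Finset.univ) (f := fun σ => σ m) (fun _ _ => Finset.mem_coe.2 (Finset.mem_univ _))
  rw [Finset.card_univ, Fintype.card_perm, Fintype.card_fin, Finset.sum_congr rfl fun l _ => h1 l]
    at h2
  simpa using h2.symm

/-- The permutations with `σ m` equal to the size of `B` split into fibres over the sets of that
size avoiding `m`, and relabelling positions shows that these fibres are equinumerous. -/
theorem card_lowerPositions_eq {n : ℕ} (m : Fin n) {B : Finset (Fin n)} (hB : m ∉ B) :
    n * ((n - 1).choose B.card * (Finset.univ.filter fun σ => lowerPositions m σ = B).card) =
      n.factorial := by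
  have hlt : B.card < n := by
    have := Finset.card_lt_univ_of_notMem hB
    simpa using this
  rw [← card_perm_apply_eq m ⟨B.card, hlt⟩]
  congr 1
  rw [Finset.card_eq_sum_card_fiberwise (f := lowerPositions m)
    (s := Finset.univ.filter fun σ : Equiv.Perm (Fin n) => σ m = ⟨B.card, hlt⟩)
    (t := (Finset.univ.erase m).powersetCard B.card)]
  · rw [Finset.sum_congr rfl (g := fun _ =>
      (Finset.univ.filter fun σ => lowerPositions m σ = B).card)]
    · simp
    · intro C hC
      rw [Finset.mem_powersetCard] at hC
      have hmC : m ∉ C := fun h => by simpa using hC.1 h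
      rw [card_lowerPositions_eq_congr m hB hmC hC.2.symm, Finset.filter_filter]
      congr 1
      refine Finset.filter_congr fun σ _ => ⟨fun h => h.2, fun h => ⟨?_, h⟩⟩
      rw [Fin.ext_iff, ← card_lowerPositions, h, hC.2]
  · intro σ hσ
    simp only [Finset.coe_filter, Finset.mem_univ, true_and, Set.mem_ofPred_eq] at hσ
    rw [Finset.mem_coe, Finset.mem_powersetCard, card_lowerPositions, hσ]
    refine ⟨fun j hj => ?_, rfl⟩
    rw [mem_lowerPositions] at hj
    simp only [Finset.mem_erase, Finset.mem_univ, and_true]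
    rintro rfl
    exact lt_irrefl _ hj

/-! ### Beta integrals and the Bernoulli mixture. -/

theorem integral_pow_mul_one_sub_pow (a b : ℕ) :
    ((a + b + 1 : ℕ) : ℂ) * (((a + b).choose a : ℂ) *
      ∫ u in (0 : ℝ)..1, (u : ℂ) ^ a * (1 - (u : ℂ)) ^ b) = 1 := by
  have h := Complex.betaIntegral_eq_Gamma_mul_div ((a : ℂ) + 1) ((b : ℂ) + 1)
    (by simp; positivity) (by simp; positivity)
  have e : (a : ℂ) + 1 + (b + 1) = ((a + b + 1 : ℕ) : ℂ) + 1 := by push_cast; ring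
  rw [e, Complex.Gamma_nat_eq_factorial, Complex.Gamma_nat_eq_factorial,
    Complex.Gamma_nat_eq_factorial, Complex.betaIntegral] at h
  simp only [add_sub_cancel_right, Complex.cpow_natCast] at h
  rw [h, Nat.factorial_succ, ← Nat.add_choose_mul_factorial_mul_factorial a b]
  have h1 : ((a + b).choose a : ℂ) ≠ 0 := by
    exact_mod_cast (Nat.choose_pos (Nat.le_add_right a b)).ne'
  have h2 : (a.factorial : ℂ) ≠ 0 := by exact_mod_cast a.factorial_ne_zero
  have h3 : (b.factorial : ℂ) ≠ 0 := by exact_mod_cast b.factorial_ne_zero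
  have h4 : ((a + b + 1 : ℕ) : ℂ) ≠ 0 := by exact_mod_cast (a + b).succ_ne_zero
  push_cast at h4 ⊢
  rw [← Nat.choose_symm_add]
  field_simp

/-- Expanding the product over subsets, the weight of each `B` is a Beta integral, which is exactly
the probability that `B` is the set of lower positions. -/
theorem sum_perm_prod_lowerPositions {n : ℕ} (m : Fin n) (w : Fin n → ℂ) :
    ∑ σ : Equiv.Perm (Fin n), ∏ j ∈ lowerPositions m σ, w j =
      n.factorial * ∫ u in (0 : ℝ)..1, ∏ j ∈ Finset.univ.erase m, (u * w j + (1 - u)) := by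
  have hmaps : ∀ σ ∈ (Finset.univ : Finset (Equiv.Perm (Fin n))),
      lowerPositions m σ ∈ (Finset.univ.erase m).powerset := fun σ _ => by
    rw [Finset.mem_powerset]
    intro j hj
    rw [mem_lowerPositions] at hj
    simp only [Finset.mem_erase, Finset.mem_univ, and_true]
    rintro rfl
    exact lt_irrefl _ hj
  rw [← Finset.sum_fiberwise_of_maps_to hmaps]
  simp_rw [Finset.prod_add]
  rw [intervalIntegral.integral_finsetSum fun B _ =>
    (by fun_prop : Continuous _).intervalIntegrable _ _, Finset.mul_sum]
  refine Finset.sum_congr rfl fun B hB => ?_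
  have hsub := Finset.mem_powerset.1 hB
  have hmB : m ∉ B := fun h => by simpa using hsub h
  have hcard : (Finset.univ.erase m \ B).card = n - 1 - B.card := by
    rw [Finset.card_sdiff_of_subset hsub, Finset.card_erase_of_mem (Finset.mem_univ m)]
    simp
  have hlt : B.card < n := by simpa using Finset.card_lt_univ_of_notMem hmB
  rw [Finset.sum_congr rfl (g := fun _ => ∏ j ∈ B, w j) fun σ hσ => by
    rw [(Finset.mem_filter.1 hσ).2]]
  simp only [Finset.sum_const, nsmul_eq_mul, Finset.prod_mul_distrib, Finset.prod_const, hcard]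
  have hint := integral_pow_mul_one_sub_pow B.card (n - 1 - B.card)
  rw [show B.card + (n - 1 - B.card) + 1 = n by omega,
    show B.card + (n - 1 - B.card) = n - 1 by omega] at hint
  have hN := card_lowerPositions_eq m hmB
  rw [← hN]
  simp_rw [mul_right_comm _ (∏ j ∈ B, w j)]
  rw [intervalIntegral.integral_mul_const]
  push_cast
  linear_combination (-((Finset.univ.filter fun σ => lowerPositions m σ = B).card : ℂ) *
    ∏ j ∈ B, w j) * hint

/-! ### The degree as a signed sum, and asymptotics of the middle vertex. -/

theorem degree_permGraph {n : ℕ} (m : Fin n) (σ : Equiv.Perm (Fin n)) :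
    ((permGraph σ).degree m : ℝ) =
      (m : ℕ) + ∑ j ∈ lowerPositions m σ, if j < m then (-1 : ℝ) else 1 := by
  have h1 : ((m : ℕ) : ℝ) = ∑ j : Fin n, if j < m then (1 : ℝ) else 0 := by
    rw [Finset.sum_boole, Finset.filter_gt_eq_Iio, Fin.card_Iio]
  have h2 : (permGraph σ).neighborFinset m =
      Finset.univ.filter fun j => (permGraph σ).Adj m j := by
    ext j; simp
  rw [h1, ← SimpleGraph.card_neighborFinset_eq_degree, h2, ← Finset.sum_boole, lowerPositions,
    Finset.sum_filter, ← Finset.sum_add_distrib]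
  refine Finset.sum_congr rfl fun j _ => ?_
  have hadj : (permGraph σ).Adj m j ↔ (j < m ∧ σ m < σ j) ∨ (m < j ∧ σ j < σ m) := by
    change (((m : ℕ) : ℤ) - ((j : ℕ) : ℤ)) * (((σ m : ℕ) : ℤ) - ((σ j : ℕ) : ℤ)) < 0 ↔ _
    rw [mul_neg_iff]
    simp only [Fin.lt_def]
    omega
  simp only [hadj]
  rcases lt_trichotomy j m with h | rfl | h
  · rcases lt_or_gt_of_ne (σ.injective.ne h.ne) with h' | h'
    · simp [h, h', h.not_gt, h'.not_gt]
    · simp [h, h', h'.not_gt]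
  · simp
  · rcases lt_or_gt_of_ne (σ.injective.ne h.ne) with h' | h'
    · simp [h.not_gt, h'.not_gt]
    · simp [h, h', h.not_gt]

theorem midVertex_cases (n : ℕ+) :
    (n : ℕ) = 2 * (midVertex n : ℕ) + 1 ∨ (n : ℕ) = 2 * (midVertex n : ℕ) + 2 := by
  have h : ⌈((n : ℕ) : ℝ) / 2⌉₊ = ((n : ℕ) + 1) / 2 := by
    have hn := n.pos
    rw [Nat.ceil_eq_iff (by omega)]
    constructor
    · rw [lt_div_iff₀ two_pos]
      exact_mod_cast (by omega : (((n : ℕ) + 1) / 2 - 1) * 2 < (n : ℕ))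
    · rw [div_le_iff₀ two_pos]
      exact_mod_cast (by omega : (n : ℕ) ≤ ((n : ℕ) + 1) / 2 * 2)
  have h' : (midVertex n : ℕ) = ((n : ℕ) + 1) / 2 - 1 := by rw [← h, midVertex]
  have hn := n.pos
  omega

theorem tendsto_midVertex_div :
    Tendsto (fun n : ℕ+ => ((midVertex n : ℕ) : ℝ) / ((n : ℕ) : ℝ)) atTop (𝓝 (1 / 2)) := by
  have h1 : Tendsto (fun n : ℕ+ => (((n : ℕ) : ℝ))⁻¹) atTop (𝓝 0) :=
    tendsto_inv_atTop_nhds_zero_nat.comp tendsto_PNat_val_atTop_atTop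
  have h2 : Tendsto (fun n : ℕ+ => (1 / 2 : ℝ) - (((n : ℕ) : ℝ))⁻¹) atTop (𝓝 (1 / 2)) := by
    simpa using tendsto_const_nhds.sub h1
  refine tendsto_of_tendsto_of_tendsto_of_le_of_le h2 tendsto_const_nhds (fun n => ?_) fun n => ?_
  all_goals
    have hn : (0 : ℝ) < (n : ℕ) := by exact_mod_cast n.pos
  · have : ((n : ℕ) : ℝ) ≤ 2 * (midVertex n : ℕ) + 2 := by
      have := midVertex_cases n
      exact_mod_cast (by omega : (n : ℕ) ≤ 2 * (midVertex n : ℕ) + 2)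
    change (1 / 2 : ℝ) - (((n : ℕ) : ℝ))⁻¹ ≤ ((midVertex n : ℕ) : ℝ) / ((n : ℕ) : ℝ)
    rw [le_div_iff₀ hn, sub_mul, inv_mul_cancel₀ hn.ne']
    linarith
  · have : 2 * ((midVertex n : ℕ) : ℝ) ≤ (n : ℕ) := by
      have := midVertex_cases n
      exact_mod_cast (by omega : 2 * (midVertex n : ℕ) ≤ (n : ℕ))
    change ((midVertex n : ℕ) : ℝ) / ((n : ℕ) : ℝ) ≤ 1 / 2
    rw [div_le_iff₀ hn]
    linarith

theorem tendsto_sqrt_mul_midVertex_div_sub :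
    Tendsto (fun n : ℕ+ => √((n : ℕ) : ℝ) * (((midVertex n : ℕ) : ℝ) / ((n : ℕ) : ℝ) - 1 / 2))
      atTop (𝓝 0) := by
  have h1 : Tendsto (fun n : ℕ+ => (√((n : ℕ) : ℝ))⁻¹) atTop (𝓝 0) :=
    tendsto_inv_atTop_zero.comp (Real.tendsto_sqrt_atTop.comp
      (tendsto_natCast_atTop_atTop.comp tendsto_PNat_val_atTop_atTop))
  refine squeeze_zero_norm (fun n => ?_) h1
  have hn : (0 : ℝ) < (n : ℕ) := by exact_mod_cast n.pos
  have hs := Real.sqrt_pos.2 hn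
  have hss := Real.mul_self_sqrt hn.le
  have hb : |((midVertex n : ℕ) : ℝ) / ((n : ℕ) : ℝ) - 1 / 2| ≤ ((n : ℕ) : ℝ)⁻¹ := by
    have h1 : ((midVertex n : ℕ) : ℝ) / ((n : ℕ) : ℝ) - 1 / 2 =
        (((midVertex n : ℕ) : ℝ) - (n : ℕ) / 2) * ((n : ℕ) : ℝ)⁻¹ := by field_simp
    rw [h1, abs_mul, abs_of_pos (inv_pos.2 hn)]
    refine mul_le_of_le_one_left (inv_pos.2 hn).le ?_
    rw [abs_le]
    rcases midVertex_cases n with h | h <;>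
    · have h' : ((n : ℕ) : ℝ) = _ := congrArg Nat.cast h
      push_cast at h'
      constructor <;> linarith
  rw [Real.norm_eq_abs, abs_mul, abs_of_pos hs]
  refine (mul_le_mul_of_nonneg_left hb hs.le).trans_eq ?_
  rw [← hss]
  field_simp
  rw [Real.sqrt_sq hs.le]

/-! ### Limits of the Bernoulli characteristic functions. -/

theorem tendsto_one_add_pow_exp_of_tendsto_mul {ι : Type*} {l : Filter ι} {g : ι → ℝ} {k : ι → ℕ}
    {t : ℝ} (hg : Tendsto g l (𝓝 0)) (hk : Tendsto (fun i => (k i : ℝ) * g i) l (𝓝 t)) :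
    Tendsto (fun i => (1 + g i) ^ k i) l (𝓝 (Real.exp t)) := by
  have hpos : ∀ᶠ i in l, 0 < 1 + g i :=
    (hg.eventually_const_lt (by norm_num : (-1 : ℝ) < 0)).mono fun i hi => by linarith
  -- Sandwich: g/(1+g) ≤ log(1+g) ≤ g.
  have hlow : Tendsto (fun i => (k i : ℝ) * g i / (1 + g i)) l (𝓝 t) := by
    have h := hk.div (hg.const_add 1) (by norm_num)
    rwa [add_zero, div_one] at h
  have hlog : Tendsto (fun i => (k i : ℝ) * Real.log (1 + g i)) l (𝓝 t) := by
    refine tendsto_of_tendsto_of_tendsto_of_le_of_le' hlow hk ?_ ?_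
    · filter_upwards [hpos] with i hi
      rw [mul_div_assoc]
      refine mul_le_mul_of_nonneg_left ?_ (Nat.cast_nonneg _)
      refine le_trans (le_of_eq ?_) (Real.one_sub_inv_le_log_of_pos hi)
      field_simp
      ring
    · filter_upwards [hpos] with i hi
      refine mul_le_mul_of_nonneg_left ?_ (Nat.cast_nonneg _)
      linarith [Real.log_le_sub_one_of_pos hi]
  refine ((Real.continuous_exp.tendsto t).comp hlog).congr' ?_
  filter_upwards [hpos] with i hi
  rw [Function.comp_apply, Real.exp_nat_mul, Real.exp_log hi]

/-- The product is 1 - u(1-u)(2 - 2 cos s); writing it with `Real.sinc` exhibits the order s²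
without dividing by s. -/
theorem mul_exp_mul_I_mul_conj (u s : ℝ) :
    (u * Complex.exp (((-s : ℝ) : ℂ) * Complex.I) + (1 - u)) *
        (u * Complex.exp (s * Complex.I) + (1 - u)) =
      ((1 + -(u * (1 - u) * s ^ 2 * Real.sinc (s / 2) ^ 2) : ℝ) : ℂ) := by
  have hs : s ^ 2 * Real.sinc (s / 2) ^ 2 = 2 - 2 * Real.cos s := by
    have h1 : s * Real.sinc (s / 2) = 2 * Real.sin (s / 2) := by
      rcases eq_or_ne s 0 with rfl | h
      · simp
      · rw [Real.sinc_of_ne_zero (by simpa using h)]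
        field_simp
    have h2 := Real.cos_sq' (s / 2)
    have h3 := Real.cos_two_mul (s / 2)
    rw [mul_div_cancel₀ s two_ne_zero] at h3
    rw [← mul_pow, h1, h3, h2]
    ring
  have h1 : Complex.exp (((-s : ℝ) : ℂ) * Complex.I) * Complex.exp (s * Complex.I) = 1 := by
    rw [← Complex.exp_add]; simp
  have h2 : Complex.exp (((-s : ℝ) : ℂ) * Complex.I) + Complex.exp (s * Complex.I) =
      2 * (Real.cos s : ℂ) := by
    rw [Complex.ofReal_cos, Complex.two_cos, add_comm]; push_cast; rfl
  rw [mul_assoc (u * (1 - u)), hs]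
  push_cast at h1 h2 ⊢
  linear_combination (u : ℂ) ^ 2 * h1 + (u : ℂ) * (1 - u) * h2

theorem norm_mul_exp_mul_I_add_le {u : ℝ} (hu : u ∈ Set.Icc (0 : ℝ) 1) (s : ℝ) :
    ‖(u : ℂ) * Complex.exp (s * Complex.I) + (1 - u)‖ ≤ 1 := by
  refine (norm_add_le _ _).trans ?_
  rw [norm_mul, Complex.norm_exp_ofReal_mul_I, ← Complex.ofReal_one, ← Complex.ofReal_sub,
    Complex.norm_real, Complex.norm_real, Real.norm_of_nonneg hu.1,
    Real.norm_of_nonneg (sub_nonneg.2 hu.2)]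
  linarith

theorem tendsto_div_sqrt_pnat (t : ℝ) :
    Tendsto (fun n : ℕ+ => t / √((n : ℕ) : ℝ)) atTop (𝓝 0) :=
  tendsto_const_nhds.div_atTop (Real.tendsto_sqrt_atTop.comp
      (tendsto_natCast_atTop_atTop.comp tendsto_PNat_val_atTop_atTop))

theorem tendsto_bernoulli_charFun_pow (u t : ℝ) :
    Tendsto (fun n : ℕ+ =>
      (u * Complex.exp (((-(t / √((n : ℕ) : ℝ)) : ℝ) : ℂ) * Complex.I) + (1 - u)) ^
          (midVertex n : ℕ) *
        (u * Complex.exp (((t / √((n : ℕ) : ℝ) : ℝ) : ℂ) * Complex.I) + (1 - u)) ^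
          ((n : ℕ) - 1 - (midVertex n : ℕ)))
      atTop (𝓝 (Complex.exp (-(u * (1 - u) * t ^ 2 / 2)))) := by
  have hs := tendsto_div_sqrt_pnat t
  set s : ℕ+ → ℝ := fun n => t / √((n : ℕ) : ℝ) with hsdef
  have hsinc : Tendsto (fun n => Real.sinc (s n / 2) ^ 2) atTop (𝓝 1) := by
    have := (by fun_prop : Continuous fun x : ℝ => Real.sinc (x / 2) ^ 2).tendsto' 0 1 (by simp)
    exact this.comp hs
  have hg : Tendsto (fun n => -(u * (1 - u) * s n ^ 2 * Real.sinc (s n / 2) ^ 2)) atTop (𝓝 0) := by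
    simpa using (((hs.pow 2).const_mul (u * (1 - u))).mul hsinc).neg
  have hmg : Tendsto (fun n => ((midVertex n : ℕ) : ℝ) *
      -(u * (1 - u) * s n ^ 2 * Real.sinc (s n / 2) ^ 2)) atTop
      (𝓝 (-(u * (1 - u) * t ^ 2 / 2))) := by
    have h := ((tendsto_midVertex_div.mul hsinc).const_mul (-(u * (1 - u) * t ^ 2)))
    rw [show -(u * (1 - u) * t ^ 2) * (1 / 2 * 1) = -(u * (1 - u) * t ^ 2 / 2) by ring] at h
    refine h.congr fun n => ?_
    simp only [hsdef]
    rw [div_pow, Real.sq_sqrt (Nat.cast_nonneg _)]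
    ring
  have hpow := (Complex.continuous_ofReal.tendsto _).comp
    (tendsto_one_add_pow_exp_of_tendsto_mul hg hmg)
  have hz : Tendsto (fun n => (u * Complex.exp ((s n : ℂ) * Complex.I) + (1 - u))) atTop
      (𝓝 1) := by
    have := (by fun_prop : Continuous fun x : ℝ =>
      (u * Complex.exp ((x : ℂ) * Complex.I) + (1 - u))).tendsto' 0 1 (by simp)
    exact this.comp hs
  -- After pairing, one factor is left over when n is even and none when n is odd.
  have hz' : Tendsto (fun n => (u * Complex.exp ((s n : ℂ) * Complex.I) + (1 - u)) ^
      ((n : ℕ) - 1 - 2 * (midVertex n : ℕ))) atTop (𝓝 1) := by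
    have h1 : Tendsto (fun n => ‖(u * Complex.exp ((s n : ℂ) * Complex.I) + (1 - u)) - 1‖) atTop
        (𝓝 0) := by
      simpa using (hz.sub_const 1).norm
    rw [tendsto_iff_norm_sub_tendsto_zero]
    refine squeeze_zero (fun _ => norm_nonneg _) (fun n => ?_) h1
    rcases midVertex_cases n with h | h
    · rw [show (n : ℕ) - 1 - 2 * (midVertex n : ℕ) = 0 by omega, pow_zero, sub_self, norm_zero]
      exact norm_nonneg _
    · rw [show (n : ℕ) - 1 - 2 * (midVertex n : ℕ) = 1 by omega, pow_one]
  have hmul := hpow.mul hz'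
  rw [mul_one, Complex.ofReal_exp] at hmul
  push_cast at hmul
  refine hmul.congr fun n => ?_
  have he : (n : ℕ) - 1 - (midVertex n : ℕ) =
      (midVertex n : ℕ) + ((n : ℕ) - 1 - 2 * (midVertex n : ℕ)) := by
    have := midVertex_cases n
    omega
  rw [he, pow_add, ← mul_assoc, ← mul_pow, mul_exp_mul_I_mul_conj, Function.comp_apply,
    Complex.ofReal_pow]

theorem tendsto_integral_bernoulli_charFun_pow (t : ℝ) :
    Tendsto (fun n : ℕ+ => ∫ u in (0 : ℝ)..1,
      (u * Complex.exp (((-(t / √((n : ℕ) : ℝ)) : ℝ) : ℂ) * Complex.I) + (1 - u)) ^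
          (midVertex n : ℕ) *
        (u * Complex.exp (((t / √((n : ℕ) : ℝ) : ℝ) : ℂ) * Complex.I) + (1 - u)) ^
          ((n : ℕ) - 1 - (midVertex n : ℕ)))
      atTop (𝓝 (∫ u in (0 : ℝ)..1, Complex.exp (-(u * (1 - u) * t ^ 2 / 2)))) := by
  refine intervalIntegral.tendsto_integral_filter_of_dominated_convergence (fun _ => 1)
    (Eventually.of_forall fun n => (by fun_prop : Continuous _).aestronglyMeasurable)
    (Eventually.of_forall fun n => Eventually.of_forall fun u hu => ?_)
    intervalIntegrable_const
    (Eventually.of_forall fun u _ => tendsto_bernoulli_charFun_pow u t)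
  rw [Set.uIoc_of_le zero_le_one] at hu
  rw [norm_mul, norm_pow, norm_pow]
  exact mul_le_one₀ (pow_le_one₀ (norm_nonneg _) (norm_mul_exp_mul_I_add_le ⟨hu.1.le, hu.2⟩ _))
    (by positivity) (pow_le_one₀ (norm_nonneg _) (norm_mul_exp_mul_I_add_le ⟨hu.1.le, hu.2⟩ _))

/-! ### Characteristic functions of the mixture and of the degree. -/

theorem charFun_normalMixture (t : ℝ) :
    charFun normalMixture t = ∫ u in (0 : ℝ)..1, Complex.exp (-(u * (1 - u) * t ^ 2 / 2)) := by
  let κ : Kernel ℝ ℝ := ⟨_, measurable_normalMixture_kernel⟩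
  have : IsMarkovKernel κ := ⟨fun u => by
    change IsProbabilityMeasure (gaussianReal 0 (u * (1 - u)).toNNReal); infer_instance⟩
  -- As a marginal of a joint law, the mixture can be integrated by Fubini.
  have hbind : normalMixture = (volume.restrict (Set.Icc (0 : ℝ) 1) ⊗ₘ κ).snd := by
    rw [Measure.snd_compProd]; rfl
  have hc : Continuous fun x : ℝ => Complex.exp (t * x * Complex.I) := by fun_prop
  rw [charFun_apply_real, hbind, Measure.snd, integral_map measurable_snd.aemeasurable
    hc.aestronglyMeasurable, Measure.integral_compProd, intervalIntegral.integral_of_le zero_le_one,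
    integral_Icc_eq_integral_Ioc]
  · refine setIntegral_congr_fun measurableSet_Ioc fun u hu => ?_
    have h := charFun_gaussianReal (μ := 0) (v := (u * (1 - u)).toNNReal) t
    rw [charFun_apply_real] at h
    refine h.trans ?_
    rw [Real.coe_toNNReal _ (mul_nonneg hu.1.le (sub_nonneg.2 hu.2))]
    simp
  · refine Integrable.of_bound (C := 1)
      (hc.comp continuous_snd).aestronglyMeasurable (Eventually.of_forall fun p => ?_)
    rw [← Complex.ofReal_mul, Complex.norm_exp_ofReal_mul_I]

theorem integral_uniformOn_perm {n : ℕ} (f : Equiv.Perm (Fin n) → ℂ) :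
    ∫ σ, f σ ∂(uniformOn Set.univ) = (n.factorial : ℂ)⁻¹ * ∑ σ, f σ := by
  rw [uniformOn, ProbabilityTheory.cond, Measure.restrict_univ, integral_smul_measure,
    integral_count, Measure.count_univ, ENat.card_eq_coe_fintype_card, Fintype.card_perm,
    Fintype.card_fin]
  simp

theorem charFun_degree_eq {n : ℕ} (m : Fin n) (t : ℝ) :
    ∫ σ, Complex.exp (t * ((√(n : ℝ) * (((permGraph σ).degree m : ℝ) / (n : ℝ) - 1 / 2) : ℝ) : ℂ) *
        Complex.I) ∂(uniformOn Set.univ) =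
      Complex.exp (t * ((√(n : ℝ) * (((m : ℕ) : ℝ) / (n : ℝ) - 1 / 2) : ℝ) : ℂ) * Complex.I) *
        ∫ u in (0 : ℝ)..1,
          (u * Complex.exp (((-(t / √(n : ℝ)) : ℝ) : ℂ) * Complex.I) + (1 - u)) ^ (m : ℕ) *
          (u * Complex.exp (((t / √(n : ℝ) : ℝ) : ℂ) * Complex.I) + (1 - u)) ^ (n - 1 - m) := by
  have hn : (0 : ℝ) < n := by exact_mod_cast m.pos
  let w : Fin n → ℂ := fun j =>
    Complex.exp (((t / √(n : ℝ) * if j < m then (-1 : ℝ) else 1 : ℝ) : ℂ) * Complex.I)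
  have hexp : ∀ σ : Equiv.Perm (Fin n),
      Complex.exp (t * ((√(n : ℝ) * (((permGraph σ).degree m : ℝ) / (n : ℝ) - 1 / 2) : ℝ) : ℂ) *
        Complex.I) =
      Complex.exp (t * ((√(n : ℝ) * (((m : ℕ) : ℝ) / (n : ℝ) - 1 / 2) : ℝ) : ℂ) * Complex.I) *
        ∏ j ∈ lowerPositions m σ, w j := fun σ => by
    rw [← Complex.exp_sum, ← Complex.exp_add, ← Finset.sum_mul, ← add_mul, ← Complex.ofReal_sum,
      ← Finset.mul_sum, ← Complex.ofReal_mul, ← Complex.ofReal_mul, ← Complex.ofReal_add,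
      degree_permGraph]
    congr 3
    have hs : √(n : ℝ) / n = 1 / √(n : ℝ) := Real.sqrt_div_self'
    have hs' : t / √(n : ℝ) = t * (√(n : ℝ) / n) := by rw [hs]; ring
    rw [hs']
    ring
  rw [integral_uniformOn_perm, Finset.sum_congr rfl fun σ _ => hexp σ, ← Finset.mul_sum,
    sum_perm_prod_lowerPositions, mul_left_comm, inv_mul_cancel_left₀
      (by exact_mod_cast n.factorial_ne_zero)]
  congr 1
  refine intervalIntegral.integral_congr fun u _ => ?_
  have hsplit : Finset.univ.erase m = Finset.Iio m ∪ Finset.Ioi m := by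
    ext j
    simp [lt_or_lt_iff_ne]
  have hdisj : Disjoint (Finset.Iio m) (Finset.Ioi m) := by
    rw [Finset.disjoint_left]
    intro j h1 h2
    exact lt_asymm (Finset.mem_Iio.1 h1) (Finset.mem_Ioi.1 h2)
  simp only [hsplit]
  rw [Finset.prod_union hdisj]
  congr 1
  · rw [Finset.prod_congr rfl (g := fun _ =>
      (u * Complex.exp (((-(t / √(n : ℝ)) : ℝ) : ℂ) * Complex.I) + (1 - u))) fun j hj => by
        simp only [w, if_pos (Finset.mem_Iio.1 hj), mul_neg_one]]
    rw [Finset.prod_const, Fin.card_Iio]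
  · rw [Finset.prod_congr rfl (g := fun _ =>
      (u * Complex.exp (((t / √(n : ℝ) : ℝ) : ℂ) * Complex.I) + (1 - u))) fun j hj => by
        simp only [w, if_neg (Finset.mem_Ioi.1 hj).not_gt, mul_one]]
    rw [Finset.prod_const, Fin.card_Ioi]

/-- Lévy's continuity theorem for sequences over `ℕ`, transported along the order isomorphism with
`ℕ+`. -/
theorem tendsto_probabilityMeasure_of_tendsto_charFun_pnat {μ : ℕ+ → ProbabilityMeasure ℝ}
    {μ₀ : ProbabilityMeasure ℝ}
    (h : ∀ t : ℝ, Tendsto (fun n => charFun (μ n : Measure ℝ) t) atTop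
      (𝓝 (charFun (μ₀ : Measure ℝ) t))) :
    Tendsto μ atTop (𝓝 μ₀) := by
  have h1 : Tendsto (fun k : ℕ => μ (OrderIso.pnatIsoNat.symm k)) atTop (𝓝 μ₀) :=
    ProbabilityMeasure.tendsto_of_tendsto_charFun fun t =>
      (h t).comp OrderIso.pnatIsoNat.symm.tendsto_atTop
  refine (h1.comp OrderIso.pnatIsoNat.tendsto_atTop).congr fun n => ?_
  simp

theorem mainTheorem3
    {Ω : ℕ+ → Type*} {mΩ : ∀ n, MeasurableSpace (Ω n)}
    (P : ∀ n, Measure (Ω n)) [∀ n, IsProbabilityMeasure (P n)]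
    (π : ∀ n : ℕ+, Ω n → Equiv.Perm (Fin n))
    (hπ : ∀ n : ℕ+, HasLaw (π n) (uniformOn (Set.univ : Set (Equiv.Perm (Fin n)))) (P n))
    {Ω' : Type*} {mΩ' : MeasurableSpace Ω'} (P' : Measure Ω') [IsProbabilityMeasure P']
    (Z : Ω' → ℝ) (hZ : HasLaw Z normalMixture P') :
    TendstoInDistribution
      (fun (n : ℕ+) (ω : Ω n) =>
        √((n : ℕ) : ℝ) *
          (((permGraph (π n ω)).degree (midVertex n) : ℝ) / ((n : ℕ) : ℝ) - 1 / 2))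
      atTop Z P P' := by
  have hmeas : ∀ n, AEMeasurable (fun ω : Ω n => √((n : ℕ) : ℝ) *
      (((permGraph (π n ω)).degree (midVertex n) : ℝ) / ((n : ℕ) : ℝ) - 1 / 2)) (P n) := fun n =>
    (measurable_from_top (f := fun σ : Equiv.Perm (Fin n) => √((n : ℕ) : ℝ) *
      (((permGraph σ).degree (midVertex n) : ℝ) / ((n : ℕ) : ℝ) - 1 / 2))).comp_aemeasurable
      (hπ n).aemeasurable
  refine ⟨hmeas, hZ.aemeasurable,
    tendsto_probabilityMeasure_of_tendsto_charFun_pnat fun t => ?_⟩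
  simp only [ProbabilityMeasure.coe_mk]
  rw [hZ.map_eq, charFun_normalMixture]
  have hphase : Tendsto (fun n : ℕ+ => Complex.exp (t * ((√((n : ℕ) : ℝ) *
      (((midVertex n : ℕ) : ℝ) / ((n : ℕ) : ℝ) - 1 / 2) : ℝ) : ℂ) * Complex.I)) atTop (𝓝 1) := by
    have := (by fun_prop : Continuous fun x : ℝ =>
      Complex.exp (t * (x : ℂ) * Complex.I)).tendsto' 0 1 (by simp)
    exact this.comp tendsto_sqrt_mul_midVertex_div_sub
  have hlim := hphase.mul (tendsto_integral_bernoulli_charFun_pow t)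
  rw [one_mul] at hlim
  refine hlim.congr fun n => ?_
  rw [← charFun_degree_eq, charFun_apply_real, integral_map (hmeas n)
    (by fun_prop : Continuous fun x : ℝ =>
      Complex.exp (t * (x : ℂ) * Complex.I)).aestronglyMeasurable]
  exact ((hπ n).integral_comp (f := fun σ => Complex.exp (t * ((√((n : ℕ) : ℝ) *
    (((permGraph σ).degree (midVertex n) : ℝ) / ((n : ℕ) : ℝ) - 1 / 2) : ℝ) : ℂ) * Complex.I))
    measurable_from_top.aestronglyMeasurable).symm
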